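/- Let $d \ge 0$ be an integer and let $G$ be a finite simple bipartite graph that is $d$-degenerate, i.e. its vertices can be ordered so that each vertex has at most $d$ neighbors preceding it in the ordering. Let $L$ be a $(d+1)$-assignment for $G$, i.e. $L$ assigns to each vertex $v \in V(G)$ a set $L(v)$ of exactly $d+1$ colors. Let $r$ be a request of $L$, i.e. a function $r$ with non-empty domain $D \subseteq V(G)$ such that $r(v) \in L(v)$ for each $v \in D$, and suppose that $|D| = 1$. Then $(G,L,r)$ is $1$-satisfiable. Here, $(G,L,r)$ is called $\epsilon$-satisfiable if there is a proper $L$-coloring $f$ of $G$ (that is, $f(v) \in L(v)$ for every $v \in V(G)$ and $f(u) \ne f(v)$ whenever $u$ and $v$ are adjacent) such that $f(v) = r(v)$ for at least $\epsilon|D|$ vertices $v \in D$. In other words, $G$ has a proper $L$-coloring that gives the requested color to the unique vertex of $D$. -/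

import Mathlib

/-- `G` is `d`-degenerate: the vertices can be ordered so that each vertex has at most `d`
neighbors preceding it in the ordering. -/
def IsDegenerate {V : Type*} [Fintype V] (G : SimpleGraph V) (d : ℕ) : Prop :=
  ∃ e : V ≃ Fin (Fintype.card V), ∀ v : V, {u : V | G.Adj v u ∧ e u < e v}.ncard ≤ d

/-- The list assignment `L` is a `k`-assignment: every list consists of exactly `k` colors. -/
def IsListAssignment {V C : Type*} (L : V → Finset C) (k : ℕ) : Prop :=
  ∀ v : V, (L v).card = k

/-- A request of the list assignment `L`: a function with non-empty domain contained in the vertex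
set which picks, for each vertex of its domain, a color in the list of that vertex. -/
structure Request {V C : Type*} (L : V → Finset C) where
  /-- The set of vertices at which a color is requested. -/
  domain : Finset V
  domain_nonempty : domain.Nonempty
  /-- The requested colors. -/
  color : {v : V // v ∈ domain} → C
  color_mem : ∀ v : {v : V // v ∈ domain}, color v ∈ L v

/-- `(G, L, r)` is `ε`-satisfiable: some proper `L`-coloring of `G` agrees with the request `r` in
at least `ε * |domain of r|` vertices of the domain of `r`. -/
def IsSatisfiable {V C : Type*} (G : SimpleGraph V) (L : V → Finset C) (r : Request L)
    (ε : ℝ) : Prop :=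
  ∃ f : G.Coloring C, (∀ v : V, f v ∈ L v) ∧
    ε * (r.domain.card : ℝ) ≤ ({v : {v : V // v ∈ r.domain} | f v = r.color v}.ncard : ℝ)

/-!
The requested vertex `v` is coloured with its requested colour, and the rest of the graph is
coloured greedily along kernels of a suitable orientation.

* A `d`-degenerate graph can be oriented with all out-degrees at most `d` and with the prescribed
  vertex `v` a sink (`IsDegenerate.exists_orientation`). This is Hall's theorem, matching every edge
  to one of `d` slots at an endpoint other than `v`: a set of edges whose endpoints form the set `U`
  has at most `d * (|U| - 1)` elements, because every edge is counted at its later endpoint and the first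
  vertex of `U` is not the later endpoint of any edge.
* In an orientation of a bipartite graph every set of vertices has a kernel
  (`exists_isKernel_of_crossing`), so the lemma of Bondy, Boppana and Siegel
  (`exists_coloring_of_kernels`) gives a list colouring as soon as every list is larger than the
  corresponding out-degree.

After `v` is coloured with `c`, each neighbour of `v` may lose the colour `c`, but, as `v` is a sink,
it also loses the out-neighbour `v`; hence the lists on the remaining vertices are still larger than
the out-degrees.
-/

/-- `K` is a kernel of the subdigraph of `o` induced on `S`: no arc joins two vertices of `K`, and
every vertex of `S` outside `K` has an out-neighbour in `K`. -/
structure IsKernel {V : Type*} (o : V → V → Prop) (S K : Finset V) : Prop where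
  subset : K ⊆ S
  independent : ∀ x ∈ K, ∀ y ∈ K, ¬ o x y
  absorbing : ∀ x ∈ S, x ∉ K → ∃ y ∈ K, o x y

open Classical in
/-- If every vertex of `A` in `S` has an out-neighbour in `S`, then the other side of `S` is a kernel;
otherwise a sink in `A` is put into the kernel and deleted together with its in-neighbours. -/
theorem exists_isKernel_of_crossing {V : Type*} {o : V → V → Prop} {A : Set V}
    (hA : ∀ x y, o x y → (x ∈ A ↔ y ∉ A)) (S : Finset V) : ∃ K, IsKernel o S K := by
  induction S using Finset.strongInduction with
  | H S ih =>
    by_cases h : ∀ x ∈ S, x ∈ A → ∃ y ∈ S, o x y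
    · refine ⟨S.filter (· ∉ A), Finset.filter_subset _ _, ?_, ?_⟩
      · intro x hx y hy hxy
        exact (Finset.mem_filter.1 hx).2 ((hA x y hxy).2 (Finset.mem_filter.1 hy).2)
      · intro x hx hxK
        have hxA : x ∈ A := by
          by_contra hn
          exact hxK (Finset.mem_filter.2 ⟨hx, hn⟩)
        obtain ⟨y, hy, hxy⟩ := h x hx hxA
        exact ⟨y, Finset.mem_filter.2 ⟨hy, (hA x y hxy).1 hxA⟩, hxy⟩
    · push Not at h
      obtain ⟨a, ha, -, hsink⟩ := h
      have hlt : S.filter (fun x => x ≠ a ∧ ¬ o x a) ⊂ S :=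
        Finset.filter_ssubset.2 ⟨a, ha, by simp⟩
      obtain ⟨K, hK⟩ := ih _ hlt
      have hKS : ∀ x ∈ K, x ∈ S ∧ x ≠ a ∧ ¬ o x a := fun x hx =>
        Finset.mem_filter.1 (hK.subset hx)
      refine ⟨insert a K, ?_, ?_, ?_⟩
      · exact Finset.insert_subset ha fun x hx => (hKS x hx).1
      · intro x hx y hy hxy
        rcases Finset.mem_insert.1 hx with rfl | hxK
        · rcases Finset.mem_insert.1 hy with rfl | hyK
          · exact hsink _ ha hxy
          · exact hsink _ (hKS y hyK).1 hxy
        · rcases Finset.mem_insert.1 hy with rfl | hyK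
          · exact (hKS x hxK).2.2 hxy
          · exact hK.independent x hxK y hyK hxy
      · intro x hx hxK
        rw [Finset.mem_insert, not_or] at hxK
        by_cases hxa : o x a
        · exact ⟨a, Finset.mem_insert_self _ _, hxa⟩
        · obtain ⟨y, hy, hxy⟩ :=
            hK.absorbing x (Finset.mem_filter.2 ⟨hx, hxK.1, hxa⟩) hxK.2
          exact ⟨y, Finset.mem_insert_of_mem hy, hxy⟩

open Classical in
/-- The lemma of Bondy, Boppana and Siegel: if all induced subdigraphs have kernels and every list is
larger than the out-degree of its vertex, then there is a proper list colouring. A kernel of the set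
of vertices whose list contains `c` is coloured with `c`; each remaining vertex that loses the
colour `c` also loses an out-neighbour. -/
theorem exists_coloring_of_kernels {V C : Type*} [Nonempty C] {o : V → V → Prop}
    (hker : ∀ S, ∃ K, IsKernel o S K) (S : Finset V) (L : V → Finset C)
    (hL : ∀ u ∈ S, (S.filter (o u)).card < (L u).card) :
    ∃ f : V → C, (∀ u ∈ S, f u ∈ L u) ∧ ∀ u ∈ S, ∀ w ∈ S, o u w → f u ≠ f w := by
  induction S using Finset.strongInduction generalizing L with
  | H S ih =>
    rcases S.eq_empty_or_nonempty with rfl | ⟨s, hs⟩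
    · exact ⟨fun _ => Classical.arbitrary C, by simp, by simp⟩
    obtain ⟨c, hc⟩ : (L s).Nonempty := Finset.card_pos.1 ((Nat.zero_le _).trans_lt (hL s hs))
    obtain ⟨K, hK⟩ := hker (S.filter (c ∈ L ·))
    have hKS : ∀ x ∈ K, x ∈ S ∧ c ∈ L x := fun x hx => Finset.mem_filter.1 (hK.subset hx)
    obtain ⟨k, hk⟩ : K.Nonempty := by
      by_cases hsK : s ∈ K
      · exact ⟨s, hsK⟩
      · obtain ⟨y, hy, -⟩ := hK.absorbing s (Finset.mem_filter.2 ⟨hs, hc⟩) hsK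
        exact ⟨y, hy⟩
    have hlt : S \ K ⊂ S :=
      Finset.sdiff_ssubset (fun x hx => (hKS x hx).1) ⟨k, hk⟩
    obtain ⟨f, hfL, hf⟩ := ih _ hlt (fun u => (L u).erase c) (by
      intro u hu
      obtain ⟨huS, huK⟩ := Finset.mem_sdiff.1 hu
      have hle : (S \ K).filter (o u) ⊆ S.filter (o u) :=
        Finset.filter_subset_filter _ Finset.sdiff_subset
      by_cases huc : c ∈ L u
      · obtain ⟨y, hy, huy⟩ := hK.absorbing u (Finset.mem_filter.2 ⟨huS, huc⟩) huK
        have : (S \ K).filter (o u) ⊂ S.filter (o u) := by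
          refine (Finset.ssubset_iff_of_subset hle).2 ⟨y, ?_, ?_⟩
          · exact Finset.mem_filter.2 ⟨(hKS y hy).1, huy⟩
          · simp [hy]
        have h1 := Finset.card_lt_card this
        have h2 := hL u huS
        rw [Finset.card_erase_of_mem huc]
        omega
      · rw [Finset.erase_eq_of_notMem huc]
        exact (Finset.card_le_card hle).trans_lt (hL u huS))
    have hfL' : ∀ u ∈ S, u ∉ K → f u ≠ c ∧ f u ∈ L u := fun u hu huK =>
      Finset.mem_erase.1 (hfL u (Finset.mem_sdiff.2 ⟨hu, huK⟩))
    refine ⟨fun u => if u ∈ K then c else f u, ?_, ?_⟩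
    · intro u hu
      dsimp only
      split_ifs with huK
      · exact (hKS u huK).2
      · exact (hfL' u hu huK).2
    · intro u hu w hw huw
      dsimp only
      split_ifs with huK hwK hwK
      · exact absurd huw (hK.independent u huK w hwK)
      · exact (hfL' w hw hwK).1.symm
      · exact (hfL' u hu huK).1
      · exact hf u (Finset.mem_sdiff.2 ⟨hu, huK⟩) w (Finset.mem_sdiff.2 ⟨hw, hwK⟩) huw

open Classical in
/-- If every vertex is the later endpoint of at most `d` edges, then at most `(|U| - 1) * d` edges
have both endpoints in `U`, since the first vertex of `U` is the later endpoint of none of them. The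
edges are given as pairs whose first component is the later endpoint. -/
theorem card_edges_le_of_back_degree_le {V ι : Type*} [LinearOrder ι] {d : ℕ} (e : V → ι)
    (E : Finset (V × V)) (hlt : ∀ p ∈ E, e p.2 < e p.1)
    (hdeg : ∀ v, (E.filter (·.1 = v)).card ≤ d)
    (U : Finset V) (hU : ∀ p ∈ E, p.1 ∈ U ∧ p.2 ∈ U) : E.card ≤ (U.card - 1) * d := by
  rcases U.eq_empty_or_nonempty with rfl | hne
  · have : E = ∅ := Finset.eq_empty_of_forall_notMem fun p hp => by simpa using (hU p hp).1
    simp [this]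
  obtain ⟨m, hm, hmin⟩ := U.exists_min_image e hne
  rw [← Finset.card_erase_of_mem hm, mul_comm]
  refine Finset.card_le_mul_card_image_of_maps_to (f := Prod.fst) ?_ d fun v _ => hdeg v
  intro p hp
  refine Finset.mem_erase.2 ⟨?_, (hU p hp).1⟩
  intro h
  exact absurd (hlt p hp) (not_lt.2 (h ▸ hmin p.2 (hU p hp).2))

open Classical in
/-- A `d`-degenerate graph has an orientation with all out-degrees at most `d` in which a prescribed
vertex `v` is a sink. -/
theorem IsDegenerate.exists_orientation {V : Type*} [Fintype V] {G : SimpleGraph V} {d : ℕ}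
    (hdeg : IsDegenerate G d) (v : V) :
    ∃ o : V → V → Prop, (∀ x y, o x y → G.Adj x y) ∧ (∀ x y, G.Adj x y → o x y ∨ o y x) ∧
      (∀ y, ¬ o v y) ∧ ∀ x, (Finset.univ.filter (o x)).card ≤ d := by
  obtain ⟨e, he⟩ := hdeg
  -- Each edge is represented by the pair whose first component is its later endpoint.
  let E : Type _ := {p : V × V // G.Adj p.1 p.2 ∧ e p.2 < e p.1}
  let ends : E → Finset V := fun p => ({p.1.1, p.1.2} : Finset V)
  let t : E → Finset (V × Fin d) := fun p => (ends p).erase v ×ˢ Finset.univ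
  have hall : ∀ s : Finset E, s.card ≤ (s.biUnion t).card := by
    intro s
    have ht : s.biUnion t = (s.biUnion ends).erase v ×ˢ Finset.univ := by
      ext ⟨x, i⟩
      simp only [t, Finset.mem_biUnion, Finset.mem_product, Finset.mem_erase, Finset.mem_univ,
        and_true]
      constructor
      · rintro ⟨p, hp, hx, hxp⟩
        exact ⟨hx, p, hp, hxp⟩
      · rintro ⟨hx, p, hp, hxp⟩
        exact ⟨p, hp, hx, hxp⟩
    have hcard := card_edges_le_of_back_degree_le (d := d) e
      (s.map (Function.Embedding.subtype _)) (by
        intro p hp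
        obtain ⟨q, -, rfl⟩ := Finset.mem_map.1 hp
        exact q.2.2) (by
        intro x
        refine le_trans ?_ (he x)
        rw [← Set.ncard_coe_finset]
        refine Set.ncard_le_ncard_of_injOn Prod.snd ?_ ?_ (Set.toFinite _)
        · intro p hp
          obtain ⟨hpE, rfl⟩ := Finset.mem_filter.1 (Finset.mem_coe.1 hp)
          obtain ⟨q, -, rfl⟩ := Finset.mem_map.1 hpE
          exact q.2
        · intro p hp q hq hpq
          exact Prod.ext ((Finset.mem_filter.1 hp).2.trans (Finset.mem_filter.1 hq).2.symm) hpq)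
      (s.biUnion ends) (by
        intro p hp
        obtain ⟨q, hq, rfl⟩ := Finset.mem_map.1 hp
        exact ⟨Finset.mem_biUnion.2 ⟨q, hq, by simp [ends]⟩,
          Finset.mem_biUnion.2 ⟨q, hq, by simp [ends]⟩⟩)
    rw [Finset.card_map] at hcard
    rw [ht, Finset.card_product, Finset.card_univ, Fintype.card_fin]
    exact hcard.trans (Nat.mul_le_mul_right d Finset.pred_card_le_card_erase)
  obtain ⟨f, hinj, hf⟩ := (Finset.all_card_le_biUnion_card_iff_exists_injective t).1 hall
  have hf' : ∀ p : E, (f p).1 ≠ v ∧ ((f p).1 = p.1.1 ∨ (f p).1 = p.1.2) := by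
    intro p
    simpa [t, ends] using hf p
  -- An edge is an out-edge of the endpoint whose slot it is matched to.
  obtain ⟨o, ho⟩ : ∃ o : V → V → Prop, ∀ x y, o x y ↔
      ∃ p : E, (p.1 = (x, y) ∨ p.1 = (y, x)) ∧ (f p).1 = x := ⟨_, fun _ _ => Iff.rfl⟩
  refine ⟨o, ?_, ?_, ?_, ?_⟩
  · intro x y hxy
    obtain ⟨p, hp | hp, -⟩ := (ho x y).1 hxy
    · have := p.2.1
      rwa [hp] at this
    · have := p.2.1
      rw [hp] at this
      exact this.symm
  · have key : ∀ x y, G.Adj x y → e y < e x → ∃ p : E, p.1 = (x, y) :=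
      fun x y hxy hlt => ⟨⟨(x, y), hxy, hlt⟩, rfl⟩
    intro x y hxy
    have : ∃ p : E, p.1 = (x, y) ∨ p.1 = (y, x) := by
      rcases lt_or_gt_of_ne (e.injective.ne hxy.ne) with h | h
      · obtain ⟨p, hp⟩ := key y x hxy.symm h
        exact ⟨p, Or.inr hp⟩
      · obtain ⟨p, hp⟩ := key x y hxy h
        exact ⟨p, Or.inl hp⟩
    obtain ⟨p, hp⟩ := this
    have h1 : (f p).1 = x ∨ (f p).1 = y := by
      rcases hp with hp | hp <;> have := (hf' p).2 <;> rw [hp] at this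
      · exact this
      · exact this.symm
    rcases h1 with h1 | h1
    · exact Or.inl ((ho x y).2 ⟨p, hp, h1⟩)
    · exact Or.inr ((ho y x).2 ⟨p, hp.symm, h1⟩)
  · intro y hy
    obtain ⟨p, -, hp⟩ := (ho v y).1 hy
    exact (hf' p).1 hp
  · intro x
    calc _ ≤ ((Finset.univ.filter fun p : E => (f p).1 = x).image
            fun p => if p.1.1 = x then p.1.2 else p.1.1).card := by
          refine Finset.card_le_card fun y hy => ?_
          obtain ⟨p, hp, hpx⟩ := (ho x y).1 (Finset.mem_filter.1 hy).2
          refine Finset.mem_image.2 ⟨p, Finset.mem_filter.2 ⟨Finset.mem_univ _, hpx⟩, ?_⟩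
          rcases hp with hp | hp
          · simp [hp]
          · rw [hp]
            dsimp only
            split_ifs with h
            · exact h.symm
            · rfl
      _ ≤ (Finset.univ.filter fun p : E => (f p).1 = x).card := Finset.card_image_le
      _ ≤ (Finset.univ : Finset (Fin d)).card := by
          refine Finset.card_le_card_of_injOn (fun p => (f p).2) (fun _ _ => Finset.mem_univ _) ?_
          intro p hp q hq hpq
          exact hinj (Prod.ext
            ((Finset.mem_filter.1 hp).2.trans (Finset.mem_filter.1 hq).2.symm) hpq)
      _ = d := Finset.card_fin d

open Classical in
/-- A single vertex of a bipartite `d`-degenerate graph may be precoloured by any colour of its list,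
for lists of size `d + 1`. -/
theorem exists_coloring_extending_vertex {V C : Type*} [Fintype V] {G : SimpleGraph V} {d : ℕ}
    (hbip : G.IsBipartite) (hdeg : IsDegenerate G d) {L : V → Finset C}
    (hL : IsListAssignment L (d + 1)) {v : V} {c : C} (hc : c ∈ L v) :
    ∃ f : G.Coloring C, (∀ u, f u ∈ L u) ∧ f v = c := by
  obtain ⟨o, hoG, hGo, hsink, hout⟩ := hdeg.exists_orientation v
  obtain ⟨b⟩ := hbip
  have hker : ∀ S, ∃ K, IsKernel o S K := by
    refine exists_isKernel_of_crossing (A := {x | b x = 0}) fun x y hxy => ?_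
    have := b.valid (hoG x y hxy)
    simp only [Set.mem_ofPred_eq]
    omega
  have : Nonempty C := ⟨c⟩
  obtain ⟨f, hfL, hf⟩ := exists_coloring_of_kernels hker (Finset.univ.erase v)
    (fun u => if G.Adj u v then (L u).erase c else L u) (by
      intro u hu
      have hle : (Finset.univ.erase v).filter (o u) ⊆ Finset.univ.filter (o u) :=
        Finset.filter_subset_filter _ (Finset.erase_subset _ _)
      split_ifs with huv
      · -- The lost colour is compensated by the arc from `u` to the sink `v`.
        have huv' : o u v := (hGo u v huv).resolve_right (hsink u)
        have hlt : (Finset.univ.erase v).filter (o u) ⊂ Finset.univ.filter (o u) :=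
          (Finset.ssubset_iff_of_subset hle).2 ⟨v, by simp [huv'], by simp⟩
        have h1 := Finset.card_lt_card hlt
        have h2 := hout u
        have h3 := hL u
        have h4 := Finset.pred_card_le_card_erase (s := L u) (a := c)
        omega
      · have h1 := Finset.card_le_card hle
        have h2 := hout u
        have h3 := hL u
        omega)
  have hne : ∀ u, u ≠ v → f u ∈ L u ∧ (G.Adj u v → f u ≠ c) := by
    intro u hu
    have := hfL u (by simp [hu])
    split_ifs at this with huv
    · exact ⟨Finset.mem_of_mem_erase this, fun _ => Finset.ne_of_mem_erase this⟩
    · exact ⟨this, fun h => absurd h huv⟩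
  refine ⟨SimpleGraph.Coloring.mk (Function.update f v c) ?_, ?_, ?_⟩
  · intro x y hxy
    by_cases hx : x = v
    · subst hx
      rw [Function.update_self, Function.update_of_ne hxy.ne']
      exact ((hne y hxy.ne').2 hxy.symm).symm
    by_cases hy : y = v
    · subst hy
      rw [Function.update_self, Function.update_of_ne hx]
      exact (hne x hx).2 hxy
    rw [Function.update_of_ne hx, Function.update_of_ne hy]
    rcases hGo x y hxy with h | h
    · exact hf x (by simp [hx]) y (by simp [hy]) h
    · exact (hf y (by simp [hy]) x (by simp [hx]) h).symm
  · intro u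
    change Function.update f v c u ∈ L u
    by_cases hu : u = v
    · subst hu
      rwa [Function.update_self]
    · rw [Function.update_of_ne hu]
      exact (hne u hu).1
  · change Function.update f v c v = c
    exact Function.update_self v c f

theorem mainTheorem2 {V C : Type*} [Fintype V] (G : SimpleGraph V) (d : ℕ)
    (hbip : G.IsBipartite) (hdeg : IsDegenerate G d)
    (L : V → Finset C) (hL : IsListAssignment L (d + 1))
    (r : Request L) (hr : r.domain.card = 1) :
    IsSatisfiable G L r 1 := by
  obtain ⟨v, hv⟩ := r.domain_nonempty
  obtain ⟨f, hfL, hfv⟩ := exists_coloring_extending_vertex hbip hdeg hL (r.color_mem ⟨v, hv⟩)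
  refine ⟨f, hfL, ?_⟩
  rw [hr, Nat.cast_one, one_mul, Nat.one_le_cast]
  exact (Set.ncard_pos (Set.toFinite _)).2 ⟨⟨v, hv⟩, hfv⟩
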